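/- Let $D\subset\mathbb R^3$ be a measurable set (for instance a bounded Lipschitz domain), and let $q_c\in L^\infty(D)$ be real-valued with $0\le q_c(x)\le q_{c,+}<\infty$ for almost every $x\in D$. For a constant $c_0>0$ and $s\in\mathbb C$ with $\Re s=\sigma>0$, consider the volume potential $$(\hat V f)(x)=\int_D \frac{\exp(-s\|x-y\|/c_0)}{4\pi\|x-y\|}\,f(y)\,dy,\qquad x\in\mathbb R^3 .$$ Put $\|v\|_{L^2_{q_c}(D)}^2=\int_D q_c|v|^2\,dx$, $\|w\|_{H^1_s(\mathbb R^3)}^2=\|\nabla w\|_{L^2(\mathbb R^3)}^2+|s|^2\|w\|_{L^2(\mathbb R^3)}^2$ and $|w|_{H^2(\mathbb R^3)}^2=\sum_{i,j=1}^3\|\partial_i\partial_jw\|_{L^2(\mathbb R^3)}^2$. Then $\hat V$ defines a bounded linear operator from $L^2(D)$ into $H^2(\mathbb R^3)$ (for every $f\in L^2(D)$ the integral converges absolutely for every $x\in\mathbb R^3$, and it agrees with the operator almost everywhere). Moreover there is a constant $C$, depending only on $D$ and $q_c$ and in particular independent of $s$, $c_0$ and $v$, such that for all $c_0>0$, all $s$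 with $\Re s=\sigma>0$ and all $v\in L^2(D)$ $$\|\hat V(q_cv)\|_{L^2(D)}\le c_0^2\,\frac{q_{c,+}^{1/2}}{\sigma|s|}\,\|v\|_{L^2_{q_c}(D)},$$ $$\|\hat V(q_cv)\|_{H^1_s(\mathbb R^3)}\le c_0\max(1,c_0)\,\frac{q_{c,+}^{1/2}}{\sigma}\,\|v\|_{L^2_{q_c}(D)},$$ $$|\hat V(q_cv)|_{H^2(\mathbb R^3)}\le C\,\frac{|s|}{\sigma}\,\|v\|_{L^2_{q_c}(D)}.$$ In particular, for $c_0=1$ (and also for every $0<c_0\le 1$) the first two bounds hold with the constants $q_{c,+}^{1/2}/(\sigma|s|)$ and $q_{c,+}^{1/2}/\sigma$. -/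

import Mathlib

open MeasureTheory TemperedDistribution
open scoped ENNReal SchwartzMap LineDeriv

noncomputable section

namespace LippmannSchwinger

/-- Physical space `ℝ³` with its Euclidean norm. -/
abbrev R3 : Type := EuclideanSpace ℝ (Fin 3)

/-- The space `L²(ℝ³)` of complex valued functions. -/
abbrev L2R3 : Type := Lp ℂ 2 (volume : Measure R3)

/-- The space `L²(D)` of complex valued functions. -/
abbrev L2On (D : Set R3) : Type := Lp ℂ 2 ((volume : Measure R3).restrict D)

/-- The space `L^∞(D)` of real valued functions. -/
abbrev LinftyOn (D : Set R3) : Type := Lp ℝ ∞ ((volume : Measure R3).restrict D)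

/-- The fundamental solution
`Φ(x, y) = exp (-s ‖x - y‖ / c₀) / (4 π ‖x - y‖)` of `-Δ + s² / c₀²`. -/
def fundSol (c₀ : ℝ) (s : ℂ) (x y : R3) : ℂ :=
  Complex.exp (-s * (‖x - y‖ : ℂ) / (c₀ : ℂ)) / (4 * (Real.pi : ℂ) * (‖x - y‖ : ℂ))

/-- The volume potential `x ↦ ∫_D Φ(x, y) f(y) dy`. -/
def volumePotential (c₀ : ℝ) (s : ℂ) (D : Set R3) (f : R3 → ℂ) (x : R3) : ℂ :=
  ∫ y in D, fundSol c₀ s x y * f y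

/-- The Sobolev space `H²(ℝ³)`, as a subspace of `L²(ℝ³)`. -/
def H2 : Submodule ℂ L2R3 where
  carrier := {w | MemSobolev 2 2 (w : 𝓢'(R3, ℂ))}
  add_mem' := by
    intro u v hu hv
    have h := MemSobolev.add hu hv
    simp only [Set.mem_ofPred_eq]
    rw [← Lp.toTemperedDistributionCLM_apply, map_add]
    exact h
  zero_mem' := by
    simp only [Set.mem_ofPred_eq]
    rw [← Lp.toTemperedDistributionCLM_apply, map_zero]
    exact memSobolev_fun_zero R3 ℂ 2 2
  smul_mem' := by
    intro c u hu
    have h := MemSobolev.smul c hu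
    simp only [Set.mem_ofPred_eq]
    rw [← Lp.toTemperedDistributionCLM_apply, map_smul]
    exact h

open scoped Classical in
/-- The `L²` function that represents a tempered distribution (and `0` if there is none). -/
def l2Rep (T : 𝓢'(R3, ℂ)) : L2R3 :=
  if h : ∃ g : L2R3, (g : 𝓢'(R3, ℂ)) = T then h.choose else 0

theorem l2Rep_coe (g : L2R3) : l2Rep (g : 𝓢'(R3, ℂ)) = g := by
  have h : ∃ g' : L2R3, (g' : 𝓢'(R3, ℂ)) = (g : 𝓢'(R3, ℂ)) := ⟨g, rfl⟩
  rw [l2Rep, dif_pos h]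
  exact LinearMap.ker_eq_bot.mp
    (Lp.ker_toTemperedDistributionCLM_eq_bot (F := ℂ) (μ := (volume : Measure R3)) (p := 2))
    h.choose_spec

/-- The weak partial derivative `∂_i w` (in the sense of distributions), as an `L²` function. -/
def weakPartial (i : Fin 3) (w : L2R3) : L2R3 :=
  l2Rep (∂_{EuclideanSpace.single i (1 : ℝ)} (w : 𝓢'(R3, ℂ)))

/-- The second order weak partial derivative `∂_i ∂_j w`, as an `L²` function. -/
def weakPartial₂ (i j : Fin 3) (w : L2R3) : L2R3 :=
  l2Rep (∂_{EuclideanSpace.single i (1 : ℝ)}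
    (∂_{EuclideanSpace.single j (1 : ℝ)} (w : 𝓢'(R3, ℂ))))

/-- For `w ∈ H²(ℝ³)`, `weakPartial i w` really is the distributional derivative of `w`. -/
theorem weakPartial_coe {w : L2R3} (hw : w ∈ H2) (i : Fin 3) :
    (weakPartial i w : 𝓢'(R3, ℂ)) = ∂_{EuclideanSpace.single i (1 : ℝ)} (w : 𝓢'(R3, ℂ)) := by
  have hw' : MemSobolev 2 2 (w : 𝓢'(R3, ℂ)) := hw
  have h0 := (hw'.lineDerivOp (m := EuclideanSpace.single i (1 : ℝ))).mono
    (s' := 0) (by norm_num)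
  obtain ⟨g, hg⟩ := memSobolev_zero_iff.mp h0
  rw [weakPartial, hg, l2Rep_coe]

/-- For `w ∈ H²(ℝ³)`, `weakPartial₂ i j w` really is the distributional derivative of `w`. -/
theorem weakPartial₂_coe {w : L2R3} (hw : w ∈ H2) (i j : Fin 3) :
    (weakPartial₂ i j w : 𝓢'(R3, ℂ)) = ∂_{EuclideanSpace.single i (1 : ℝ)}
      (∂_{EuclideanSpace.single j (1 : ℝ)} (w : 𝓢'(R3, ℂ))) := by
  have hw' : MemSobolev 2 2 (w : 𝓢'(R3, ℂ)) := hw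
  have h0 := ((hw'.lineDerivOp (m := EuclideanSpace.single j (1 : ℝ))).lineDerivOp
    (m := EuclideanSpace.single i (1 : ℝ))).mono (s' := 0) (by norm_num)
  obtain ⟨g, hg⟩ := memSobolev_zero_iff.mp h0
  rw [weakPartial₂, hg, l2Rep_coe]

/-- `‖w‖_{L²(D)}` for `w ∈ L²(ℝ³)`. -/
def l2NormOn (D : Set R3) (w : L2R3) : ℝ :=
  Real.sqrt (∫ x in D, ‖w x‖ ^ 2)

/-- The weighted norm `‖v‖_{L²_q(D)} = (∫_D q |v|²)^{1/2}`. -/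
def weightedNorm (D : Set R3) (q : LinftyOn D) (v : L2On D) : ℝ :=
  Real.sqrt (∫ x in D, q x * ‖v x‖ ^ 2)

/-- The norm `‖w‖_{H¹_s(ℝ³)} = (‖∇w‖² + |s|² ‖w‖²)^{1/2}`. -/
def h1sNorm (s : ℂ) (w : L2R3) : ℝ :=
  Real.sqrt ((∑ i : Fin 3, ‖weakPartial i w‖ ^ 2) + ‖s‖ ^ 2 * ‖w‖ ^ 2)

/-- The seminorm `|w|_{H²(ℝ³)} = (∑_{i,j} ‖∂_i ∂_j w‖²)^{1/2}`. -/
def h2Seminorm (w : L2R3) : ℝ :=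
  Real.sqrt (∑ i : Fin 3, ∑ j : Fin 3, ‖weakPartial₂ i j w‖ ^ 2)

/-- The norm `‖w‖_{H²(ℝ³)} = (‖w‖² + ‖∇w‖² + |w|²_{H²(ℝ³)})^{1/2}`. -/
def h2Norm (w : L2R3) : ℝ :=
  Real.sqrt (‖w‖ ^ 2 + (∑ i : Fin 3, ‖weakPartial i w‖ ^ 2) + h2Seminorm w ^ 2)

end LippmannSchwinger

end

/-! Put `k = s / c₀`. The potential is convolution of the zero extension of `f` with the Yukawa
kernel, whose Fourier transform is `1 / (a + k²)` with `a = 4π²‖ξ‖²`. By Plancherel every bound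
reduces to a pointwise bound on this symbol. The key is `norm_resolvent_le`: since `Re ((a + k²) *
conj k) = Re k * (a + |k|²)`, the symbol is at most `|k| / (Re k * (a + |k|²))`. Multiplying by `1`,
by `(a + |s|²)^{1/2}` and by `a` gives the operator bounds `1 / (Re k |k|)`, `max 1 c₀ / Re k` and
`|k| / Re k`; the powers of `c₀` come from `Re k = σ / c₀` and `|k| = |s| / c₀`. The weight enters
only through `‖q v‖ ≤ √qplus * ‖v‖_{L²_q}`.

The operator is defined by its symbol, so `H²` regularity and weak derivatives are read off on the
Fourier side. That it is the integral operator (`resolvent_ae_eq`) follows from `fourier_yukawa` and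
Fourier inversion on Schwartz functions, then by density: the kernel is in `L²`, so the integral at
each fixed `x` is continuous in `f`. -/

namespace LippmannSchwinger

open Set Filter Topology FourierTransform

/-! ### The Yukawa kernel and its Fourier transform -/

/-- The Yukawa kernel `exp (-k ‖x‖) / (4 π ‖x‖)`. -/
noncomputable def yukawa {E : Type*} [Norm E] (k : ℂ) (x : E) : ℂ :=
  Complex.exp (-(k * (‖x‖ : ℂ))) / (4 * (Real.pi : ℂ) * (‖x‖ : ℂ))

theorem norm_yukawa {E : Type*} [NormedAddCommGroup E] (k : ℂ) (x : E) :
    ‖yukawa k x‖ = Real.exp (-(k.re * ‖x‖)) / (4 * Real.pi * ‖x‖) := by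
  simp [yukawa, Complex.norm_exp, abs_of_pos Real.pi_pos]

theorem measurable_yukawa {E : Type*} [NormedAddCommGroup E] [MeasurableSpace E] [BorelSpace E]
    (k : ℂ) : Measurable (yukawa k : E → ℂ) := by
  unfold yukawa
  fun_prop

theorem integrable_yukawa {k : ℂ} (hk : 0 < k.re) : Integrable (yukawa k : R3 → ℂ) := by
  rw [← integrable_norm_iff (measurable_yukawa k).aestronglyMeasurable]
  simp_rw [norm_yukawa]
  rw [integrable_fun_norm_addHaar volume
    (f := fun r => Real.exp (-(k.re * r)) / (4 * Real.pi * r))]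
  have h := (integrableOn_rpow_mul_exp_neg_mul_rpow (p := 1) (s := 1) (by norm_num) one_pos
    hk).const_mul (1 / (4 * Real.pi))
  refine IntegrableOn.congr_fun h (fun r hr => ?_) measurableSet_Ioi
  have hr' : r ≠ 0 := (mem_Ioi.mp hr).ne'
  simp
  field_simp

/-- In polar coordinates the Jacobian `r²` cancels the singularity of the squared kernel. This makes
the potential of an `L²` density converge at every point. -/
theorem memLp_yukawa {k : ℂ} (hk : 0 < k.re) : MemLp (yukawa k : R3 → ℂ) 2 := by
  rw [memLp_two_iff_integrable_sq_norm (measurable_yukawa k).aestronglyMeasurable]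
  simp_rw [norm_yukawa]
  rw [integrable_fun_norm_addHaar volume
    (f := fun r => (Real.exp (-(k.re * r)) / (4 * Real.pi * r)) ^ 2)]
  have h := (integrableOn_exp_mul_Ioi (a := -(2 * k.re)) (by linarith) 0).const_mul
    (1 / (4 * Real.pi) ^ 2)
  refine IntegrableOn.congr_fun h (fun r hr => ?_) measurableSet_Ioi
  have hr' : r ≠ 0 := (mem_Ioi.mp hr).ne'
  have : Real.exp (-(2 * k.re) * r) = Real.exp (-(k.re * r)) ^ 2 := by
    rw [← Real.exp_nat_mul]; congr 1; push_cast; ring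
  simp only [this, finrank_euclideanSpace, Fintype.card_fin, Nat.add_one_sub_one, smul_eq_mul]
  field_simp

/-- The radial primitive behind the integral of the Yukawa kernel over planes. -/
theorem integral_Ioi_yukawa_sqrt {k : ℂ} (hk : 0 < k.re) {z : ℝ} (hz : z ≠ 0) :
    ∫ r in Ioi (0 : ℝ), r • yukawa k (√(z ^ 2 + r ^ 2))
      = Complex.exp (-(k * (|z| : ℝ))) / (4 * Real.pi * k) := by
  have hk0 : k ≠ 0 := fun h => by simp [h] at hk
  have hpi : (Real.pi : ℂ) ≠ 0 := by exact_mod_cast Real.pi_ne_zero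
  have hpos : ∀ r : ℝ, 0 < z ^ 2 + r ^ 2 := fun r => by positivity
  have hρ : ∀ r : ℝ, HasDerivAt (fun r : ℝ => √(z ^ 2 + r ^ 2)) (r / √(z ^ 2 + r ^ 2)) r := by
    intro r
    have h1 : HasDerivAt (fun r : ℝ => z ^ 2 + r ^ 2) (2 * r) r := by
      simpa using (hasDerivAt_pow 2 r).const_add (z ^ 2)
    convert! h1.sqrt (hpos r).ne' using 1
    field_simp
  -- With `ρ = √(z² + r²)` one has `r dr = ρ dρ`, which cancels the `1 / ρ` of the kernel and leaves
  -- an exact exponential.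
  have hderiv : ∀ r ∈ Ici (0 : ℝ), HasDerivAt
      (fun r : ℝ => -(Complex.exp (-(k * (√(z ^ 2 + r ^ 2) : ℝ))) / (4 * Real.pi * k)))
      (r • yukawa k (√(z ^ 2 + r ^ 2))) r := by
    intro r _
    have h2 := ((((hρ r).ofReal_comp.const_mul k).neg.cexp).div_const (4 * Real.pi * k)).neg
    convert! h2 using 1
    have h3 : ((√(z ^ 2 + r ^ 2) : ℝ) : ℂ) ≠ 0 := by
      exact_mod_cast (Real.sqrt_pos.mpr (hpos r)).ne'
    simp only [yukawa, Real.norm_eq_abs, abs_of_nonneg (Real.sqrt_nonneg _), Complex.real_smul]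
    push_cast
    field_simp
    rfl
  have hle : ∀ r : ℝ, |r| ≤ √(z ^ 2 + r ^ 2) := fun r => Real.abs_le_sqrt (by nlinarith)
  have hint : IntegrableOn (fun r : ℝ => r • yukawa k (√(z ^ 2 + r ^ 2))) (Ioi 0) := by
    have h := (integrableOn_exp_mul_Ioi (a := -k.re) (by linarith) 0).const_mul (1 / (4 * Real.pi))
    refine h.mono' ?_ ?_
    · exact (measurable_id.smul ((measurable_yukawa k).comp (by fun_prop))).aestronglyMeasurable
    · filter_upwards [ae_restrict_mem measurableSet_Ioi] with r hr
      have hr' : 0 < r := hr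
      have hs := Real.sqrt_pos.mpr (hpos r)
      have hl := hle r
      rw [abs_of_pos hr'] at hl
      rw [norm_smul, norm_yukawa, Real.norm_eq_abs, Real.norm_eq_abs, abs_of_pos hr',
        abs_of_pos hs]
      have h4 : Real.exp (-(k.re * √(z ^ 2 + r ^ 2))) ≤ Real.exp (-k.re * r) := by
        apply Real.exp_le_exp.mpr
        nlinarith
      calc r * (Real.exp (-(k.re * √(z ^ 2 + r ^ 2))) / (4 * Real.pi * √(z ^ 2 + r ^ 2)))
          = (r / √(z ^ 2 + r ^ 2)) * (1 / (4 * Real.pi) *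
            Real.exp (-(k.re * √(z ^ 2 + r ^ 2)))) := by field_simp
        _ ≤ 1 * (1 / (4 * Real.pi) * Real.exp (-k.re * r)) := by
          have : r / √(z ^ 2 + r ^ 2) ≤ 1 := (div_le_one hs).mpr hl
          gcongr
        _ = _ := one_mul _
  have htend : Tendsto
      (fun r : ℝ => -(Complex.exp (-(k * (√(z ^ 2 + r ^ 2) : ℝ))) / (4 * Real.pi * k)))
      atTop (𝓝 0) := by
    have h5 : Tendsto (fun r : ℝ => √(z ^ 2 + r ^ 2)) atTop atTop :=
      tendsto_atTop_mono (fun r => (le_abs_self r).trans (hle r)) tendsto_id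
    have h6 : Tendsto (fun r : ℝ => Complex.exp (-(k * (√(z ^ 2 + r ^ 2) : ℝ)))) atTop (𝓝 0) := by
      rw [Complex.tendsto_exp_nhds_zero_iff]
      simpa using h5.const_mul_atTop hk
    simpa using (h6.div_const (4 * Real.pi * k)).neg
  rw [integral_Ioi_of_hasDerivAt_of_tendsto' hderiv hint htend]
  simp [Real.sqrt_sq_eq_abs]

theorem integral_plane_yukawa {k : ℂ} (hk : 0 < k.re) {z : ℝ} (hz : z ≠ 0) :
    ∫ y : EuclideanSpace ℝ (Fin 2), yukawa k (WithLp.toLp 2 (z, y))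
      = Complex.exp (-(k * (|z| : ℝ))) / (2 * k) := by
  have h1 : ∀ y : EuclideanSpace ℝ (Fin 2),
      yukawa k (WithLp.toLp 2 (z, y)) = yukawa k (√(z ^ 2 + ‖y‖ ^ 2)) := by
    intro y
    simp [yukawa, WithLp.prod_norm_eq_of_L2, abs_of_nonneg]
  simp_rw [h1]
  have hpi : (Real.pi : ℂ) ≠ 0 := by exact_mod_cast Real.pi_ne_zero
  have hk0 : k ≠ 0 := fun h => by simp [h] at hk
  rw [integral_fun_norm_addHaar volume (fun r => yukawa k (√(z ^ 2 + r ^ 2)))]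
  have h2 : (volume : Measure (EuclideanSpace ℝ (Fin 2))).real (Metric.ball 0 1) = Real.pi := by
    simp [Measure.real, Real.pi_pos.le]
  have h3 := integral_Ioi_yukawa_sqrt hk hz
  simp only [finrank_euclideanSpace, Fintype.card_fin, h2, Nat.add_one_sub_one, pow_one, h3]
  simp only [nsmul_eq_mul, Complex.real_smul]
  push_cast
  field_simp
  norm_num

/-- Splitting at `0` leaves two exponential integrals, with values proportional to `1 / (k - a)` and
`1 / (k + a)` for `a = 2πir`. -/
theorem fourier_exp_neg_abs {k : ℂ} (hk : 0 < k.re) (r : ℝ) :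
    ∫ z : ℝ, Real.fourierChar (-(z * r)) • (Complex.exp (-(k * (|z| : ℝ))) / (2 * k))
      = 1 / ((4 * Real.pi ^ 2 * r ^ 2 : ℝ) + k ^ 2) := by
  have hk0 : k ≠ 0 := fun h => by simp [h] at hk
  set a : ℂ := 2 * Real.pi * r * Complex.I with ha
  have hre : a.re = 0 := by simp [ha]
  have ha1 : 0 < (k - a).re := by simpa [hre] using hk
  have ha2 : (-(k + a)).re < 0 := by simpa [hre] using hk
  have e1 : EqOn (fun z : ℝ => Real.fourierChar (-(z * r)) •
      (Complex.exp (-(k * (|z| : ℝ))) / (2 * k)))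
      (fun z : ℝ => (1 / (2 * k)) * Complex.exp ((k - a) * z)) (Iic 0) := by
    intro z hz
    simp only [Circle.smul_def, Real.fourierChar_apply, abs_of_nonpos (mem_Iic.mp hz), smul_eq_mul]
    rw [mul_div_assoc', ← Complex.exp_add, one_div_mul_eq_div]
    congr 2
    rw [ha]; push_cast; ring
  have e2 : EqOn (fun z : ℝ => Real.fourierChar (-(z * r)) •
      (Complex.exp (-(k * (|z| : ℝ))) / (2 * k)))
      (fun z : ℝ => (1 / (2 * k)) * Complex.exp (-(k + a) * z)) (Ioi 0) := by
    intro z hz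
    simp only [Circle.smul_def, Real.fourierChar_apply, abs_of_pos (mem_Ioi.mp hz), smul_eq_mul]
    rw [mul_div_assoc', ← Complex.exp_add, one_div_mul_eq_div]
    congr 2
    rw [ha]; push_cast; ring
  have i1 := (integrableOn_exp_mul_complex_Iic ha1 0).const_mul (1 / (2 * k))
  have i2 := (integrableOn_exp_mul_complex_Ioi ha2 0).const_mul (1 / (2 * k))
  rw [← intervalIntegral.integral_Iic_add_Ioi
    (IntegrableOn.congr_fun i1 e1.symm measurableSet_Iic)
    (IntegrableOn.congr_fun i2 e2.symm measurableSet_Ioi),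
    setIntegral_congr_fun measurableSet_Iic e1, setIntegral_congr_fun measurableSet_Ioi e2,
    integral_const_mul, integral_const_mul, integral_exp_mul_complex_Iic ha1,
    integral_exp_mul_complex_Ioi ha2]
  have n1 : k - a ≠ 0 := fun h => by simp [h] at ha1
  have n2 : k + a ≠ 0 := fun h => by simp [h] at ha2
  have n3 : ((4 * Real.pi ^ 2 * r ^ 2 : ℝ) : ℂ) + k ^ 2 = (k - a) * (k + a) := by
    rw [ha]; push_cast; ring_nf; simp
  rw [n3]
  simp only [Complex.ofReal_zero, mul_zero, Complex.exp_zero]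
  field_simp
  ring

/-- Two vectors of equal norm are exchanged by the reflection in the hyperplane orthogonal to their
difference. -/
theorem exists_linearIsometryEquiv_prod (ξ : R3) :
    ∃ A : R3 ≃ₗᵢ[ℝ] WithLp 2 (ℝ × EuclideanSpace ℝ (Fin 2)), A ξ = WithLp.toLp 2 (‖ξ‖, 0) := by
  have hdim : Module.finrank ℝ R3
      = Module.finrank ℝ (WithLp 2 (ℝ × EuclideanSpace ℝ (Fin 2))) := by
    rw [LinearEquiv.finrank_eq (WithLp.linearEquiv 2 ℝ (ℝ × EuclideanSpace ℝ (Fin 2)))]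
    simp
  let B : R3 ≃ₗᵢ[ℝ] WithLp 2 (ℝ × EuclideanSpace ℝ (Fin 2)) :=
    
    (stdOrthonormalBasis ℝ _).equiv (stdOrthonormalBasis ℝ _) (finCongr hdim)
  refine ⟨B.trans (Submodule.reflection
    (ℝ ∙ (B ξ - WithLp.toLp 2 (‖ξ‖, 0)))ᗮ), ?_⟩
  exact Submodule.reflection_sub (by simp)

/-- By radial symmetry `ξ` may be rotated onto the first axis. The phase then depends on one
coordinate only, so Fubini first integrates the kernel over planes and leaves a one-dimensional
transform. -/
theorem fourier_yukawa {k : ℂ} (hk : 0 < k.re) (ξ : R3) :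
    𝓕 (yukawa k : R3 → ℂ) ξ = 1 / ((4 * Real.pi ^ 2 * ‖ξ‖ ^ 2 : ℝ) + k ^ 2) := by
  obtain ⟨A, hA⟩ := exists_linearIsometryEquiv_prod ξ
  have hcomp : (yukawa k : R3 → ℂ)
      = (yukawa k : WithLp 2 (ℝ × EuclideanSpace ℝ (Fin 2)) → ℂ) ∘ A := by
    ext x; simp [yukawa]
  have hmp := WithLp.volume_preserving_toLp ℝ (EuclideanSpace ℝ (Fin 2))
  have hemb : MeasurableEmbedding (@WithLp.toLp 2 (ℝ × EuclideanSpace ℝ (Fin 2))) :=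
    (MeasurableEquiv.toLp 2 (ℝ × EuclideanSpace ℝ (Fin 2))).measurableEmbedding
  have hint : Integrable (yukawa k : WithLp 2 (ℝ × EuclideanSpace ℝ (Fin 2)) → ℂ) := by
    have := integrable_yukawa hk
    rw [hcomp] at this
    exact (A.measurePreserving.integrable_comp_emb A.toHomeomorph.measurableEmbedding).mp this
  rw [hcomp, Real.fourier_comp_linearIsometry, hA, Real.fourier_eq]
  have hint2 := (Real.fourierIntegral_convergent_iff (WithLp.toLp 2 (‖ξ‖, 0))).mpr hint
  rw [← hmp.integral_comp hemb, Measure.volume_eq_prod, integral_prod]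
  · rw [← fourier_exp_neg_abs hk ‖ξ‖]
    apply integral_congr_ae
    filter_upwards [compl_mem_ae_iff.mpr (measure_singleton (0 : ℝ))] with z hz
    rw [← integral_plane_yukawa hk hz, Circle.smul_def, ← integral_smul]
    congr 1 with y
    simp [WithLp.prod_inner_apply, Circle.smul_def, mul_comm]
  · rw [← Measure.volume_eq_prod]
    exact (hmp.integrable_comp_emb hemb).mpr hint2

/-! ### Fourier multipliers and distributional derivatives -/

/-- The operator on `L²(ℝ³)` with bounded Fourier symbol `g`. -/
noncomputable def multiplier (g : R3 → ℂ) (hg : MemLp g ∞ volume) : L2R3 →L[ℂ] L2R3 :=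
  fourierInvCLM ℂ L2R3 ∘L
    ((ContinuousLinearMap.mul ℂ ℂ).holderL volume ∞ 2 2 hg.toLp) ∘L fourierCLM ℂ L2R3

theorem fourier_multiplier {g : R3 → ℂ} (hg : MemLp g ∞ volume) (f : L2R3) :
    (𝓕 (multiplier g hg f) : L2R3) =ᵐ[volume] fun ξ => g ξ * (𝓕 f : L2R3) ξ := by
  have h : (𝓕 (multiplier g hg f) : L2R3)
      = (ContinuousLinearMap.mul ℂ ℂ).holder 2 hg.toLp (𝓕 f : L2R3) := by
    change 𝓕 (𝓕⁻ ((ContinuousLinearMap.mul ℂ ℂ).holder 2 hg.toLp (𝓕 f : L2R3)) : L2R3) = _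
    exact fourier_fourierInv_eq _
  rw [h]
  filter_upwards [(ContinuousLinearMap.mul ℂ ℂ).coeFn_holder (r := 2) hg.toLp (𝓕 f : L2R3),
    hg.coeFn_toLp] with ξ h1 h2
  rw [h1, h2]
  rfl

theorem smulLeftCLM_coe {g : R3 → ℂ} (hg : g.HasTemperateGrowth) {u h : L2R3}
    (hh : h =ᵐ[volume] fun ξ => g ξ * u ξ) :
    smulLeftCLM ℂ g (u : 𝓢'(R3, ℂ)) = (h : 𝓢'(R3, ℂ)) := by
  ext φ
  simp only [Lp.toTemperedDistribution_apply, smulLeftCLM_apply_apply]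
  apply integral_congr_ae
  filter_upwards [hh] with x hx
  simp only [SchwartzMap.smulLeftCLM_apply_apply hg, hx, smul_eq_mul]
  ring

/-- The Fourier transform is injective on tempered distributions and turns `∂_i` into multiplication
by `2πi ξ_i`. -/
theorem lineDeriv_coe {w v : L2R3} (i : Fin 3)
    (hv : (𝓕 v : L2R3) =ᵐ[volume]
      fun ξ => (2 * Real.pi * Complex.I * (ξ i : ℂ)) * (𝓕 w : L2R3) ξ) :
    ∂_{EuclideanSpace.single i (1 : ℝ)} (w : 𝓢'(R3, ℂ)) = (v : 𝓢'(R3, ℂ)) := by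
  have hg : (fun ξ : R3 => Complex.ofReal
      (inner ℝ ξ (EuclideanSpace.single i (1 : ℝ)))).HasTemperateGrowth := by fun_prop
  have h1 : 𝓕 (∂_{EuclideanSpace.single i (1 : ℝ)} (w : 𝓢'(R3, ℂ))) = 𝓕 (v : 𝓢'(R3, ℂ)) := by
    rw [fourier_lineDerivOp_eq, Lp.fourier_toTemperedDistribution_eq,
      Lp.fourier_toTemperedDistribution_eq, ← smul_apply,
      ← smulLeftCLM_smul hg]
    refine smulLeftCLM_coe (by fun_prop) ?_
    filter_upwards [hv] with ξ hξ
    rw [hξ]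
    simp [EuclideanSpace.inner_single_right]
  have h2 := congrArg (fun T : 𝓢'(R3, ℂ) => 𝓕⁻ T) h1
  simpa using h2

/-! ### Pointwise bounds on the resolvent symbol -/

/-- The Fourier symbol of the inverse of `-Δ + k²`. -/
noncomputable def resolventSymbol (k : ℂ) (ξ : R3) : ℂ :=
  1 / ((4 * Real.pi ^ 2 * ‖ξ‖ ^ 2 : ℝ) + k ^ 2)

theorem measurable_resolventSymbol (k : ℂ) : Measurable (resolventSymbol k) := by
  unfold resolventSymbol
  fun_prop

/-- Test `a + k²` against `conj k`: the real part of the product is `Re k * (a + |k|²)`, and it is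
at most the modulus. This is coercivity after rotation by the phase of `k`. -/
theorem norm_resolvent_le {k : ℂ} (hk : 0 < k.re) {a : ℝ} (ha : 0 ≤ a) :
    ‖1 / ((a : ℂ) + k ^ 2)‖ ≤ ‖k‖ / (k.re * (a + ‖k‖ ^ 2)) := by
  have hkn : 0 < ‖k‖ := hk.trans_le (Complex.re_le_norm k)
  have h1 : k.re * (a + ‖k‖ ^ 2) ≤ ‖(a : ℂ) + k ^ 2‖ * ‖k‖ := by
    have h2 : (((a : ℂ) + k ^ 2) * (starRingEnd ℂ) k).re = k.re * (a + ‖k‖ ^ 2) := by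
      rw [← Complex.normSq_eq_norm_sq, Complex.normSq_apply]
      simp [pow_two]
      ring
    rw [← h2]
    refine (Complex.re_le_norm _).trans ?_
    rw [norm_mul, Complex.norm_conj]
  have h3 : 0 < k.re * (a + ‖k‖ ^ 2) := by positivity
  have h4 : 0 < ‖(a : ℂ) + k ^ 2‖ := by
    by_contra h
    have : ‖(a : ℂ) + k ^ 2‖ = 0 := le_antisymm (not_lt.mp h) (norm_nonneg _)
    rw [this, zero_mul] at h1
    linarith
  rw [norm_div, norm_one, div_le_div_iff₀ h4 h3, one_mul, mul_comm ‖k‖]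
  exact h1

theorem norm_resolventSymbol_le {k : ℂ} (hk : 0 < k.re) (ξ : R3) :
    ‖resolventSymbol k ξ‖ ≤ ‖k‖ / (k.re * (4 * Real.pi ^ 2 * ‖ξ‖ ^ 2 + ‖k‖ ^ 2)) :=
  norm_resolvent_le hk (by positivity)

theorem memLp_mul_resolventSymbol {k : ℂ} (hk : 0 < k.re) {p : R3 → ℂ} (hp : Measurable p)
    {c : ℝ} (hpc : ∀ ξ, ‖p ξ‖ ≤ c * (1 + ‖ξ‖ ^ 2)) :
    MemLp (fun ξ => p ξ * resolventSymbol k ξ) ∞ volume := by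
  have hkn : 0 < ‖k‖ := hk.trans_le (Complex.re_le_norm k)
  have hc : 0 ≤ c := by simpa using (norm_nonneg _).trans (hpc 0)
  refine memLp_top_of_bound (hp.mul (measurable_resolventSymbol k)).aestronglyMeasurable
    (c * ((1 / ‖k‖ ^ 2 + 1 / (4 * Real.pi ^ 2)) * (‖k‖ / k.re))) (ae_of_all _ fun ξ => ?_)
  have hpi := Real.pi_pos
  -- Expanding the product, the diagonal terms give `1 + ‖ξ‖²` exactly and the cross terms are
  -- nonnegative.
  have h1 : 1 + ‖ξ‖ ^ 2 ≤
      (1 / ‖k‖ ^ 2 + 1 / (4 * Real.pi ^ 2)) * (4 * Real.pi ^ 2 * ‖ξ‖ ^ 2 + ‖k‖ ^ 2) := by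
    have e : (1 / ‖k‖ ^ 2 + 1 / (4 * Real.pi ^ 2)) * (4 * Real.pi ^ 2 * ‖ξ‖ ^ 2 + ‖k‖ ^ 2)
      = 1 + ‖ξ‖ ^ 2 + (4 * Real.pi ^ 2 * ‖ξ‖ ^ 2 / ‖k‖ ^ 2 + ‖k‖ ^ 2 / (4 * Real.pi ^ 2)) := by
      field_simp
      ring
    rw [e]
    exact le_add_of_nonneg_right (by positivity)
  have hpos : 0 < 4 * Real.pi ^ 2 * ‖ξ‖ ^ 2 + ‖k‖ ^ 2 := by positivity
  calc ‖p ξ * resolventSymbol k ξ‖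
      ≤ (c * ((1 / ‖k‖ ^ 2 + 1 / (4 * Real.pi ^ 2)) * (4 * Real.pi ^ 2 * ‖ξ‖ ^ 2 + ‖k‖ ^ 2))) *
        (‖k‖ / (k.re * (4 * Real.pi ^ 2 * ‖ξ‖ ^ 2 + ‖k‖ ^ 2))) := by
        rw [norm_mul]
        exact mul_le_mul ((hpc ξ).trans (by gcongr)) (norm_resolventSymbol_le hk ξ)
          (norm_nonneg _) (by positivity)
    _ = _ := by field_simp

theorem memLp_resolventSymbol {k : ℂ} (hk : 0 < k.re) :
    MemLp (resolventSymbol k) ∞ volume := by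
  simpa using memLp_mul_resolventSymbol hk (p := fun _ => 1) measurable_const (c := 1)
    (fun ξ => by simp)

/-- The inverse of `-Δ + k²` on `L²(ℝ³)`. -/
noncomputable def resolvent (k : ℂ) (hk : 0 < k.re) : L2R3 →L[ℂ] L2R3 :=
  multiplier (resolventSymbol k) (memLp_resolventSymbol hk)

/-- The symbol of `∂_i`. -/
noncomputable def partialSymbol (i : Fin 3) (ξ : R3) : ℂ :=
  2 * Real.pi * Complex.I * (ξ i : ℂ)

theorem measurable_partialSymbol (i : Fin 3) : Measurable (partialSymbol i) := by
  unfold partialSymbol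
  fun_prop

theorem norm_partialSymbol (i : Fin 3) (ξ : R3) : ‖partialSymbol i ξ‖ = 2 * Real.pi * |ξ i| := by
  simp [partialSymbol, abs_of_pos Real.pi_pos]

theorem sum_norm_partialSymbol_sq (ξ : R3) :
    ∑ i, ‖partialSymbol i ξ‖ ^ 2 = 4 * Real.pi ^ 2 * ‖ξ‖ ^ 2 := by
  simp_rw [norm_partialSymbol, EuclideanSpace.norm_sq_eq, Finset.mul_sum, Real.norm_eq_abs]
  exact Finset.sum_congr rfl fun i _ => by ring

theorem norm_partialSymbol_le (i : Fin 3) (ξ : R3) : ‖partialSymbol i ξ‖ ≤ 2 * Real.pi * ‖ξ‖ := by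
  rw [norm_partialSymbol]
  have := PiLp.norm_apply_le ξ i
  rw [Real.norm_eq_abs] at this
  gcongr

theorem memLp_partialSymbol_mul {k : ℂ} (hk : 0 < k.re) (i : Fin 3) :
    MemLp (fun ξ => partialSymbol i ξ * resolventSymbol k ξ) ∞ volume := by
  refine memLp_mul_resolventSymbol hk (measurable_partialSymbol i) (c := 2 * Real.pi) fun ξ => ?_
  refine (norm_partialSymbol_le i ξ).trans ?_
  have : ‖ξ‖ ≤ 1 + ‖ξ‖ ^ 2 := by nlinarith [sq_nonneg (‖ξ‖ - 1)]
  gcongr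

theorem memLp_partialSymbol_mul_mul {k : ℂ} (hk : 0 < k.re) (i j : Fin 3) :
    MemLp (fun ξ => (partialSymbol i ξ * partialSymbol j ξ) * resolventSymbol k ξ) ∞ volume := by
  refine memLp_mul_resolventSymbol hk
    ((measurable_partialSymbol i).mul (measurable_partialSymbol j))
    (c := (2 * Real.pi) ^ 2) fun ξ => ?_
  rw [norm_mul]
  refine (mul_le_mul (norm_partialSymbol_le i ξ) (norm_partialSymbol_le j ξ) (norm_nonneg _)
    (by positivity)).trans ?_
  nlinarith [sq_nonneg (2 * Real.pi)]

/-! ### Regularity and norm bounds for the resolvent -/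

section

variable {k : ℂ} (hk : 0 < k.re) (f : L2R3)

theorem fourier_resolvent :
    (𝓕 (resolvent k hk f) : L2R3) =ᵐ[volume] fun ξ => resolventSymbol k ξ * (𝓕 f : L2R3) ξ :=
  fourier_multiplier _ f

theorem lineDeriv_resolvent (i : Fin 3) :
    ∂_{EuclideanSpace.single i (1 : ℝ)} (resolvent k hk f : 𝓢'(R3, ℂ))
      = (multiplier _ (memLp_partialSymbol_mul hk i) f : 𝓢'(R3, ℂ)) := by
  refine lineDeriv_coe i ?_
  filter_upwards [fourier_resolvent hk f, fourier_multiplier (memLp_partialSymbol_mul hk i) f]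
    with ξ h1 h2
  rw [h1, h2, partialSymbol, mul_assoc]

theorem lineDeriv_lineDeriv_resolvent (i j : Fin 3) :
    ∂_{EuclideanSpace.single i (1 : ℝ)} (∂_{EuclideanSpace.single j (1 : ℝ)}
      (resolvent k hk f : 𝓢'(R3, ℂ)))
      = (multiplier _ (memLp_partialSymbol_mul_mul hk i j) f : 𝓢'(R3, ℂ)) := by
  rw [lineDeriv_resolvent]
  refine lineDeriv_coe i ?_
  filter_upwards [fourier_multiplier (memLp_partialSymbol_mul hk j) f,
    fourier_multiplier (memLp_partialSymbol_mul_mul hk i j) f] with ξ h1 h2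
  rw [h1, h2, partialSymbol]
  ring

theorem weakPartial_resolvent (i : Fin 3) :
    weakPartial i (resolvent k hk f) = multiplier _ (memLp_partialSymbol_mul hk i) f := by
  rw [weakPartial, lineDeriv_resolvent, l2Rep_coe]

theorem weakPartial₂_resolvent (i j : Fin 3) :
    weakPartial₂ i j (resolvent k hk f)
      = multiplier _ (memLp_partialSymbol_mul_mul hk i j) f := by
  rw [weakPartial₂, lineDeriv_lineDeriv_resolvent, l2Rep_coe]

/-- The Bessel weight `1 + ‖ξ‖²` times the resolvent symbol is still bounded. -/
theorem resolvent_mem_H2 : resolvent k hk f ∈ H2 := by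
  change MemSobolev 2 2 (resolvent k hk f : 𝓢'(R3, ℂ))
  rw [memSobolev_iff_exists_smulLeftCLM_fourier]
  have hp : Measurable fun ξ : R3 => (((1 + ‖ξ‖ ^ 2) ^ ((2 : ℝ) / 2) : ℝ) : ℂ) := by fun_prop
  have hb : ∀ ξ : R3, ‖(((1 + ‖ξ‖ ^ 2) ^ ((2 : ℝ) / 2) : ℝ) : ℂ)‖ ≤ 1 * (1 + ‖ξ‖ ^ 2) := by
    intro ξ
    rw [Complex.norm_real, Real.norm_eq_abs, div_self two_ne_zero, Real.rpow_one,
      abs_of_pos (by positivity), one_mul]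
  refine ⟨𝓕 (multiplier _ (memLp_mul_resolventSymbol hk hp hb) f), ?_⟩
  rw [Lp.fourier_toTemperedDistribution_eq]
  refine smulLeftCLM_coe (by fun_prop) ?_
  filter_upwards [fourier_resolvent hk f,
    fourier_multiplier (memLp_mul_resolventSymbol hk hp hb) f] with ξ h1 h2
  rw [h1, h2, mul_assoc]

theorem norm_sq_eq_integral {α : Type*} [MeasurableSpace α] {μ : Measure α} (u : Lp ℂ 2 μ) :
    ‖u‖ ^ 2 = ∫ x, ‖u x‖ ^ 2 ∂μ := by
  have h2 : ((‖u‖ ^ 2 : ℝ) : ℂ) = ((∫ x, ‖u x‖ ^ 2 ∂μ : ℝ) : ℂ) :=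
    calc ((‖u‖ ^ 2 : ℝ) : ℂ) = inner ℂ u u := by
          rw [inner_self_eq_norm_sq_to_K]; push_cast; rfl
      _ = ∫ x, inner ℂ (u x) (u x) ∂μ := L2.inner_def u u
      _ = ∫ x, ((‖u x‖ ^ 2 : ℝ) : ℂ) ∂μ := by
          congr with x
          rw [inner_self_eq_norm_sq_to_K]; push_cast; rfl
      _ = _ := integral_ofReal
  exact_mod_cast h2

/-- Whole families are bounded at once because the Sobolev norms are square sums; bounding each
component separately would lose the sharp constants. -/
theorem sum_norm_sq_le_of_ae {α ι : Type*} [MeasurableSpace α] {μ : Measure α} [Fintype ι]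
    (h : ι → Lp ℂ 2 μ) (u : Lp ℂ 2 μ) {M : ℝ}
    (hM : ∀ᵐ x ∂μ, ∑ i, ‖h i x‖ ^ 2 ≤ M ^ 2 * ‖u x‖ ^ 2) :
    ∑ i, ‖h i‖ ^ 2 ≤ M ^ 2 * ‖u‖ ^ 2 := by
  have hint : ∀ v : Lp ℂ 2 μ, Integrable (fun x => ‖v x‖ ^ 2) μ := fun v =>
    (memLp_two_iff_integrable_sq_norm (Lp.aestronglyMeasurable v)).mp (Lp.memLp v)
  simp_rw [norm_sq_eq_integral]
  rw [← integral_finsetSum _ fun i _ => hint (h i), ← integral_const_mul]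
  exact integral_mono_ae (integrable_finsetSum _ fun i _ => hint (h i))
    ((hint u).const_mul _) hM

/-- If the symbols `g i` satisfy `∑ |g i|² ≤ M²`, the multipliers satisfy the same bound. -/
theorem sum_norm_multiplier_sq_le {ι : Type*} [Fintype ι] {g : ι → R3 → ℂ}
    (hg : ∀ i, MemLp (g i) ∞ volume) {M : ℝ} (hM : ∀ ξ, ∑ i, ‖g i ξ‖ ^ 2 ≤ M ^ 2) :
    ∑ i, ‖multiplier (g i) (hg i) f‖ ^ 2 ≤ M ^ 2 * ‖f‖ ^ 2 := by
  have h := sum_norm_sq_le_of_ae (fun i => (𝓕 (multiplier (g i) (hg i) f) : L2R3))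
    (𝓕 f : L2R3) (M := M) (by
      filter_upwards [ae_all_iff.mpr fun i => fourier_multiplier (hg i) f] with ξ hξ
      simp_rw [hξ, norm_mul, mul_pow, ← Finset.sum_mul]
      gcongr
      exact hM ξ)
  simpa using h

theorem norm_resolvent_apply_le : ‖resolvent k hk f‖ ≤ 1 / (k.re * ‖k‖) * ‖f‖ := by
  have hkn : 0 < ‖k‖ := hk.trans_le (Complex.re_le_norm k)
  have h := sum_norm_multiplier_sq_le f (ι := Unit) (fun _ => memLp_resolventSymbol hk)
    (M := 1 / (k.re * ‖k‖)) (fun ξ => by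
      simp only [Finset.univ_unique, Finset.sum_const, Finset.card_singleton, one_smul]
      gcongr
      refine (norm_resolventSymbol_le hk ξ).trans ?_
      rw [div_le_div_iff₀ (by positivity) (by positivity)]
      nlinarith [show 0 ≤ k.re * (4 * Real.pi ^ 2 * ‖ξ‖ ^ 2) by positivity])
  simp only [Finset.univ_unique, Finset.sum_const, Finset.card_singleton, one_smul,
    ← mul_pow] at h
  exact le_of_sq_le_sq h (by positivity)

theorem h1sNorm_resolvent_le {c₀ : ℝ} (hc : 0 < c₀) {s : ℂ} (hs : ‖s‖ = c₀ * ‖k‖) :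
    h1sNorm s (resolvent k hk f) ≤ max 1 c₀ / k.re * ‖f‖ := by
  have hkn : 0 < ‖k‖ := hk.trans_le (Complex.re_le_norm k)
  have hm : (1 : ℝ) ≤ max 1 c₀ := le_max_left _ _
  -- The index `none` carries the zeroth order term `s w` and `some i` carries `∂_i w`, so one
  -- multiplier estimate covers the full norm.
  let g : Option (Fin 3) → R3 → ℂ := fun o ξ =>
    o.elim (s * resolventSymbol k ξ) fun i => partialSymbol i ξ * resolventSymbol k ξ
  have hg : ∀ o, MemLp (g o) ∞ volume := fun o => by
    cases o with
    | none => exact (memLp_resolventSymbol hk).const_mul s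
    | some i => exact memLp_partialSymbol_mul hk i
  have hnone : multiplier (g none) (hg none) f = s • resolvent k hk f := by
    have : (𝓕 (multiplier (g none) (hg none) f) : L2R3) = 𝓕 (s • resolvent k hk f) := by
      rw [fourier_smul]
      apply Lp.ext
      filter_upwards [fourier_multiplier (hg none) f, fourier_resolvent hk f,
        Lp.coeFn_smul s (𝓕 (resolvent k hk f) : L2R3)] with ξ h1 h2 h3
      rw [h1, h3, Pi.smul_apply, h2, smul_eq_mul, ← mul_assoc]
      rfl
    have h2 := congrArg (fun T : L2R3 => 𝓕⁻ T) this
    simpa using h2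
  have h := sum_norm_multiplier_sq_le f hg (M := max 1 c₀ / k.re) (fun ξ => by
    rw [Fintype.sum_option]
    simp only [g, Option.elim, norm_mul, mul_pow, ← Finset.sum_mul, sum_norm_partialSymbol_sq]
    rw [← add_mul]
    set a : ℝ := 4 * Real.pi ^ 2 * ‖ξ‖ ^ 2 with ha
    have ha0 : 0 ≤ a := by positivity
    -- The norm is weighted by `s` but the symbol by `k`; comparing `c₀² |k|² + a` with `|k|² + a`
    -- costs `max 1 c₀ ^ 2`.
    have h1 : ‖s‖ ^ 2 + a ≤ max 1 c₀ ^ 2 * (a + ‖k‖ ^ 2) := by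
      rw [hs, mul_pow]
      have h2 : c₀ ^ 2 ≤ max 1 c₀ ^ 2 := by gcongr; exact le_max_right _ _
      have h3 : 1 ≤ max 1 c₀ ^ 2 := one_le_pow₀ hm
      nlinarith [sq_nonneg ‖k‖]
    have hb := norm_resolventSymbol_le hk ξ
    rw [← ha] at hb
    calc (‖s‖ ^ 2 + a) * ‖resolventSymbol k ξ‖ ^ 2
        ≤ (max 1 c₀ ^ 2 * (a + ‖k‖ ^ 2)) * (‖k‖ / (k.re * (a + ‖k‖ ^ 2))) ^ 2 := by gcongr
      _ = (max 1 c₀ / k.re) ^ 2 * (‖k‖ ^ 2 / (a + ‖k‖ ^ 2)) := by field_simp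
      _ ≤ (max 1 c₀ / k.re) ^ 2 * 1 := by
        gcongr
        rw [div_le_one (by positivity)]
        linarith
      _ = _ := mul_one _)
  rw [Fintype.sum_option, hnone, norm_smul, mul_pow, ← mul_pow (max 1 c₀ / k.re)] at h
  rw [h1sNorm]
  simp_rw [weakPartial_resolvent]
  rw [add_comm]
  exact (Real.sqrt_le_sqrt h).trans_eq (Real.sqrt_sq (by positivity))

/-- The squared symbols of all `∂_i ∂_j` sum to `a²`, and `a / (a + |k|²) ≤ 1`. -/
theorem h2Seminorm_resolvent_le : h2Seminorm (resolvent k hk f) ≤ ‖k‖ / k.re * ‖f‖ := by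
  have hkn : 0 < ‖k‖ := hk.trans_le (Complex.re_le_norm k)
  have h := sum_norm_multiplier_sq_le f (ι := Fin 3 × Fin 3)
    (fun p => memLp_partialSymbol_mul_mul hk p.1 p.2)
    (M := ‖k‖ / k.re) (fun ξ => by
      simp only [norm_mul, mul_pow, ← Finset.sum_mul]
      rw [Fintype.sum_prod_type]
      simp only [← Finset.mul_sum, ← Finset.sum_mul, sum_norm_partialSymbol_sq]
      set a : ℝ := 4 * Real.pi ^ 2 * ‖ξ‖ ^ 2 with ha
      have ha0 : 0 ≤ a := by positivity
      have hb := norm_resolventSymbol_le hk ξ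
      rw [← ha] at hb
      calc a * a * ‖resolventSymbol k ξ‖ ^ 2
          ≤ a * a * (‖k‖ / (k.re * (a + ‖k‖ ^ 2))) ^ 2 := by gcongr
        _ = (‖k‖ / k.re) ^ 2 * (a / (a + ‖k‖ ^ 2)) ^ 2 := by field_simp
        _ ≤ (‖k‖ / k.re) ^ 2 * 1 ^ 2 := by
          gcongr
          rw [div_le_one (by positivity)]
          nlinarith [sq_nonneg ‖k‖]
        _ = _ := by ring)
  rw [Fintype.sum_prod_type, ← mul_pow] at h
  rw [h2Seminorm]
  simp_rw [weakPartial₂_resolvent]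
  exact (Real.sqrt_le_sqrt h).trans_eq (Real.sqrt_sq (by positivity))

end

/-! ### The resolvent as convolution with the Yukawa kernel -/

/-- On `L¹ ∩ L²` the inverse Fourier transform of `L²` is given by the Fourier integral. -/
theorem fourierInv_toLp_ae_eq {g : R3 → ℂ} (hg1 : Integrable g) (hg2 : MemLp g 2) :
    (𝓕⁻ (hg2.toLp g) : L2R3) =ᵐ[volume] 𝓕⁻ g := by
  have hcont : Continuous (𝓕⁻ g) :=
    VectorFourier.fourierIntegral_continuous Real.continuous_fourierChar
      (L := -innerₗ R3) (by
        change Continuous fun p : R3 × R3 => -(inner ℝ p.1 p.2)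
        fun_prop) hg1
  -- Both sides are locally integrable, so it suffices to pair with test functions; in either
  -- pairing the inverse transform can be moved onto the other factor.
  refine ae_eq_of_integral_contDiff_smul_eq
    ((Lp.memLp (𝓕⁻ (hg2.toLp g) : L2R3)).locallyIntegrable one_le_two)
    hcont.locallyIntegrable fun φ hφ hφc => ?_
  have h1 : HasCompactSupport (Complex.ofRealCLM ∘ φ) := hφc.comp_left rfl
  have h2 := Complex.ofRealCLM.contDiff.comp hφ
  set Φ : 𝓢(R3, ℂ) := h1.toSchwartzMap h2 with hΦ
  have hΦφ : ∀ (x : R3) (z : ℂ), φ x • z = Φ x • z := fun x z => by simp [hΦ]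
  simp_rw [hΦφ]
  rw [← Lp.toTemperedDistribution_apply, ← Lp.fourierInv_toTemperedDistribution_eq,
    fourierInv_apply, Lp.toTemperedDistribution_apply]
  have h3 : ∫ x, (𝓕⁻ Φ : 𝓢(R3, ℂ)) x • (hg2.toLp g) x = ∫ x, 𝓕⁻ (Φ : R3 → ℂ) x • g x := by
    apply integral_congr_ae
    filter_upwards [hg2.coeFn_toLp] with x hx
    rw [hx, SchwartzMap.fourierInv_coe]
  rw [h3]
  have h4 := VectorFourier.integral_fourierIntegral_smul_eq_flip (L := -innerₗ R3)
    (μ := volume) (ν := volume) Real.continuous_fourierChar (by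
        change Continuous fun p : R3 × R3 => -(inner ℝ p.1 p.2)
        fun_prop) Φ.integrable hg1
  have h5 : (-innerₗ R3).flip = -innerₗ R3 := by
    ext x y
    simp [real_inner_comm]
  rw [h5] at h4
  exact h4

/-- For Schwartz `φ` the convolution is continuous and integrable, and its transform, a bounded
symbol times a Schwartz function, is integrable. Pointwise Fourier inversion therefore applies. -/
theorem resolvent_schwartz_ae_eq {k : ℂ} (hk : 0 < k.re) (φ : 𝓢(R3, ℂ)) :
    resolvent k hk (φ.toLp 2) =ᵐ[volume] fun x => ∫ y, yukawa k (x - y) * φ y := by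
  let c : R3 → ℂ := convolution (yukawa k) φ (ContinuousLinearMap.mul ℂ ℂ) volume
  have hc1 : Integrable c := (integrable_yukawa hk).integrable_convolution _ φ.integrable
  have hc2 : Continuous c := by
    refine BddAbove.continuous_convolution_right_of_integrable _ ?_ (integrable_yukawa hk)
      φ.continuous
    refine ⟨SchwartzMap.seminorm ℝ 0 0 φ, ?_⟩
    rintro _ ⟨x, rfl⟩
    exact φ.norm_le_seminorm ℝ x
  have hc3 : 𝓕 c = fun ξ => resolventSymbol k ξ * 𝓕 φ ξ := by
    ext ξ
    rw [Real.fourier_mul_convolution_eq (integrable_yukawa hk) φ.integrable, fourier_yukawa hk,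
      SchwartzMap.fourier_coe]
    rfl
  have hm := memLp_resolventSymbol hk
  have hG1 : Integrable (𝓕 c) := by
    rw [hc3]
    exact memLp_one_iff_integrable.mp (((𝓕 φ).memLp 1).mul hm)
  have hG2 : MemLp (𝓕 c) 2 := by
    rw [hc3]
    exact ((𝓕 φ).memLp 2).mul hm
  have h1 : (𝓕 (resolvent k hk (φ.toLp 2)) : L2R3) = hG2.toLp (𝓕 c) := by
    apply Lp.ext
    filter_upwards [fourier_resolvent hk (φ.toLp 2), hG2.coeFn_toLp, (𝓕 φ).coeFn_toLp 2]
      with ξ e1 e2 e3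
    rw [e1, e2, SchwartzMap.toLp_fourier_eq, e3, hc3]
  have h2 : resolvent k hk (φ.toLp 2) = (𝓕⁻ (hG2.toLp (𝓕 c)) : L2R3) := by
    rw [← h1, fourierInv_fourier_eq]
  rw [h2]
  refine (fourierInv_toLp_ae_eq hG1 hG2).trans (ae_of_all _ fun x => ?_)
  rw [hc2.fourierInv_fourier_eq hc1 hG1]
  simp only [c]
  rw [convolution_mul_swap]

theorem memLp_yukawa_sub {k : ℂ} (hk : 0 < k.re) (x : R3) :
    MemLp (fun y => yukawa k (x - y)) 2 (volume : Measure R3) :=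
  (memLp_yukawa hk).comp_measurePreserving (Measure.measurePreserving_sub_left volume x)

/-- The inverse of `-Δ + k²` is convolution with the Yukawa kernel. -/
theorem resolvent_ae_eq {k : ℂ} (hk : 0 < k.re) (f : L2R3) :
    resolvent k hk f =ᵐ[volume] fun x => ∫ y, yukawa k (x - y) * f y := by
  have hdense : DenseRange (SchwartzMap.toLpCLM ℂ (E := R3) ℂ 2 volume) :=
    SchwartzMap.denseRange_toLpCLM ENNReal.ofNat_ne_top
  obtain ⟨u, hu, hlim⟩ := mem_closure_iff_seq_limit.mp (hdense f)
  choose φ hφ using hu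
  have hlim2 : Tendsto (fun n => resolvent k hk (u n)) atTop (𝓝 (resolvent k hk f)) :=
    ((resolvent k hk).continuous.tendsto f).comp hlim
  -- `L²` convergence of the left side gives only an a.e. convergent subsequence; the right side
  -- converges at every `x`, being a continuous pairing with an `L²` kernel.
  obtain ⟨ns, hns, hae⟩ := (tendstoInMeasure_of_tendsto_Lp hlim2).exists_seq_tendsto_ae
  have hall : ∀ᵐ x ∂(volume : Measure R3), ∀ n,
      resolvent k hk (u n) x = ∫ y, yukawa k (x - y) * φ n y := by
    rw [ae_all_iff]
    intro n
    rw [← hφ n]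
    exact resolvent_schwartz_ae_eq hk (φ n)
  filter_upwards [hae, hall] with x h1 h2
  refine tendsto_nhds_unique h1 ?_
  have hpair : ∀ v : L2R3, (ContinuousLinearMap.mul ℂ ℂ).lpPairing volume 2 2
      (memLp_yukawa_sub hk x).toLp v = ∫ y, yukawa k (x - y) * v y := by
    intro v
    rw [ContinuousLinearMap.lpPairing_eq_integral]
    apply integral_congr_ae
    filter_upwards [(memLp_yukawa_sub hk x).coeFn_toLp] with y hy
    rw [hy]
    rfl
  have h3 : ∀ n, resolvent k hk (u n) x = (ContinuousLinearMap.mul ℂ ℂ).lpPairing volume 2 2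
      (memLp_yukawa_sub hk x).toLp (u n) := by
    intro n
    rw [h2, hpair]
    apply integral_congr_ae
    filter_upwards [(φ n).coeFn_toLp 2 volume] with y hy
    rw [← hφ n, ← hy]
    rfl
  simp_rw [h3]
  rw [← hpair]
  exact ((ContinuousLinearMap.continuous _).tendsto f).comp (hlim.comp hns.tendsto_atTop)

/-! ### Passage to `D` and the weighted norm -/

/-- Extension by zero from `L²(D)` to `L²(ℝ³)`. -/
noncomputable def extendZero {D : Set R3} (hD : MeasurableSet D) : L2On D →ₗ[ℂ] L2R3 where
  toFun f := ((memLp_indicator_iff_restrict hD).mpr (Lp.memLp f)).toLp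
  map_add' f g := by
    rw [← MemLp.toLp_add]
    refine MemLp.toLp_congr _ _ ?_
    rw [← indicator_add']
    exact (ae_eq_restrict_iff_indicator_ae_eq hD).mp (Lp.coeFn_add f g)
  map_smul' c f := by
    rw [RingHom.id_apply, ← MemLp.toLp_const_smul]
    refine MemLp.toLp_congr _ _ ?_
    refine ((ae_eq_restrict_iff_indicator_ae_eq hD).mp (Lp.coeFn_smul c f)).trans ?_
    exact ae_of_all _ fun x => by by_cases h : x ∈ D <;> simp [h]

theorem coeFn_extendZero {D : Set R3} (hD : MeasurableSet D) (f : L2On D) :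
    extendZero hD f =ᵐ[volume] D.indicator f :=
  ((memLp_indicator_iff_restrict hD).mpr (Lp.memLp f)).coeFn_toLp

theorem norm_extendZero {D : Set R3} (hD : MeasurableSet D) (f : L2On D) :
    ‖extendZero hD f‖ = ‖f‖ := by
  rw [Lp.norm_def, Lp.norm_def, eLpNorm_congr_ae (coeFn_extendZero hD f),
    eLpNorm_indicator_eq_eLpNorm_restrict hD]

theorem fundSol_eq_yukawa (c₀ : ℝ) (s : ℂ) (x y : R3) :
    fundSol c₀ s x y = yukawa (s / c₀) (x - y) := by
  rw [fundSol, yukawa]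
  congr 2
  ring

theorem resolvent_extendZero_ae_eq {c₀ : ℝ} {s : ℂ} (hk : 0 < (s / c₀).re) {D : Set R3}
    (hD : MeasurableSet D) (f : L2On D) :
    resolvent (s / c₀) hk (extendZero hD f) =ᵐ[volume] volumePotential c₀ s D f := by
  refine (resolvent_ae_eq hk _).trans (ae_of_all _ fun x => ?_)
  rw [volumePotential, ← integral_indicator hD]
  apply integral_congr_ae
  filter_upwards [coeFn_extendZero hD f] with y hy
  rw [hy]
  by_cases h : y ∈ D <;> simp [h, fundSol_eq_yukawa]

theorem integrableOn_fundSol_mul {c₀ : ℝ} {s : ℂ} (hk : 0 < (s / c₀).re) {D : Set R3}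
    (f : L2On D) (x : R3) : IntegrableOn (fun y => fundSol c₀ s x y * f y) D := by
  simp_rw [fundSol_eq_yukawa]
  exact ((memLp_yukawa_sub hk x).restrict D).integrable_mul (Lp.memLp f)

/-- The volume potential as an operator from `L²(D)` to `H²(ℝ³)`. -/
noncomputable def potentialOp {k : ℂ} (hk : 0 < k.re) {D : Set R3} (hD : MeasurableSet D) :
    L2On D →ₗ[ℂ] H2 :=
  ((resolvent k hk).toLinearMap ∘ₗ extendZero hD).codRestrict H2 fun _ => resolvent_mem_H2 hk _

theorem coe_potentialOp {k : ℂ} (hk : 0 < k.re) {D : Set R3} (hD : MeasurableSet D)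
    (f : L2On D) : (potentialOp hk hD f : L2R3) = resolvent k hk (extendZero hD f) := rfl

theorem l2NormOn_le_norm (D : Set R3) (w : L2R3) : l2NormOn D w ≤ ‖w‖ := by
  refine Real.sqrt_le_iff.mpr ⟨norm_nonneg _, ?_⟩
  rw [norm_sq_eq_integral]
  exact setIntegral_le_integral
    ((memLp_two_iff_integrable_sq_norm (Lp.aestronglyMeasurable w)).mp (Lp.memLp w))
    (ae_of_all _ fun x => by positivity)

/-- Pointwise `q² |v|² ≤ qplus * (q |v|²)`: only one of the two factors `q` is estimated. -/
theorem norm_smul_le_weightedNorm {D : Set R3} (q : LinftyOn D) {qplus : ℝ}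
    (hq : ∀ᵐ x ∂((volume : Measure R3).restrict D), 0 ≤ q x ∧ q x ≤ qplus) (v : L2On D) :
    ‖(q • v : L2On D)‖ ≤ √qplus * weightedNorm D q v := by
  have hnn : 0 ≤ ∫ x in D, q x * ‖v x‖ ^ 2 :=
    integral_nonneg_of_ae (by filter_upwards [hq] with x hx using mul_nonneg hx.1 (by positivity))
  rw [weightedNorm, ← Real.sqrt_mul' _ hnn]
  refine Real.le_sqrt_of_sq_le ?_
  rw [norm_sq_eq_integral, ← integral_const_mul]
  have hv := (memLp_two_iff_integrable_sq_norm (Lp.aestronglyMeasurable v)).mp (Lp.memLp v)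
  refine integral_mono_ae ?_ ?_ ?_
  · exact (memLp_two_iff_integrable_sq_norm (Lp.aestronglyMeasurable _)).mp
      (Lp.memLp (q • v : L2On D))
  · refine Integrable.const_mul (hv.bdd_mul (c := qplus) (Lp.aestronglyMeasurable q) ?_) qplus
    filter_upwards [hq] with x hx
    rw [Real.norm_eq_abs, abs_of_nonneg hx.1]
    exact hx.2
  · filter_upwards [hq, Lp.coeFn_lpSMul (r := 2) q v] with x hx h
    rw [h, Pi.smul_apply', norm_smul, mul_pow, Real.norm_eq_abs, sq_abs, pow_two, mul_assoc]
    exact mul_le_mul_of_nonneg_right hx.2 (mul_nonneg hx.1 (by positivity))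

theorem exists_h2Norm_resolvent_le {k : ℂ} (hk : 0 < k.re) :
    ∃ M : ℝ, ∀ f : L2R3, h2Norm (resolvent k hk f) ≤ M * ‖f‖ := by
  refine ⟨1 / (k.re * ‖k‖) + 1 / k.re + ‖k‖ / k.re, fun f => ?_⟩
  have h1 := norm_resolvent_apply_le hk f
  -- Here `M` may depend on `k`, so the choice `s = k`, `c₀ = 1` suffices to control the gradient.
  have h2 := h1sNorm_resolvent_le hk f one_pos (s := k) (by simp)
  have h3 := h2Seminorm_resolvent_le hk f
  have h4 : ∑ i, ‖weakPartial i (resolvent k hk f)‖ ^ 2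
      ≤ h1sNorm k (resolvent k hk f) ^ 2 := by
    rw [h1sNorm, Real.sq_sqrt (by positivity)]
    exact le_add_of_nonneg_right (by positivity)
  have n2 : 0 ≤ h1sNorm k (resolvent k hk f) := Real.sqrt_nonneg _
  have n3 : 0 ≤ h2Seminorm (resolvent k hk f) := Real.sqrt_nonneg _
  rw [max_self] at h2
  refine Real.sqrt_le_iff.mpr ⟨by positivity, ?_⟩
  have n1 := norm_nonneg (resolvent k hk f)
  calc ‖resolvent k hk f‖ ^ 2 + ∑ i, ‖weakPartial i (resolvent k hk f)‖ ^ 2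
        + h2Seminorm (resolvent k hk f) ^ 2
      ≤ (‖resolvent k hk f‖ + h1sNorm k (resolvent k hk f)
        + h2Seminorm (resolvent k hk f)) ^ 2 := by
        nlinarith [mul_nonneg n1 n2, mul_nonneg n1 n3, mul_nonneg n2 n3]
    _ ≤ _ := by
      gcongr
      rw [add_mul, add_mul]
      gcongr

end LippmannSchwinger

/-! ### The main theorem -/

theorem mainTheorem8
    (D : Set LippmannSchwinger.R3) (hD : MeasurableSet D)
    (q : LippmannSchwinger.LinftyOn D) (qplus : ℝ)
    (hq : ∀ᵐ x ∂((volume : Measure LippmannSchwinger.R3).restrict D),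
      0 ≤ q x ∧ q x ≤ qplus) :
    ∃ C : ℝ, ∀ (c₀ : ℝ) (s : ℂ), 0 < c₀ → 0 < s.re →
      ∃ V : LippmannSchwinger.L2On D →ₗ[ℂ] LippmannSchwinger.H2,
        -- `V` is given by the absolutely convergent volume potential
        (∀ f : LippmannSchwinger.L2On D,
          (∀ x : LippmannSchwinger.R3,
            IntegrableOn (fun y => LippmannSchwinger.fundSol c₀ s x y * f y) D) ∧
          ((V f : LippmannSchwinger.L2R3) : LippmannSchwinger.R3 → ℂ)
            =ᵐ[volume] LippmannSchwinger.volumePotential c₀ s D f) ∧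
        -- `V` is bounded from `L²(D)` into `H²(ℝ³)`
        (∃ M : ℝ, ∀ f : LippmannSchwinger.L2On D,
          LippmannSchwinger.h2Norm (V f) ≤ M * ‖f‖) ∧
        -- the explicit bounds
        (∀ v : LippmannSchwinger.L2On D,
          LippmannSchwinger.l2NormOn D (V (q • v : LippmannSchwinger.L2On D)) ≤
              c₀ ^ 2 * (Real.sqrt qplus / (s.re * ‖s‖)) *
                LippmannSchwinger.weightedNorm D q v ∧
          LippmannSchwinger.h1sNorm s (V (q • v : LippmannSchwinger.L2On D)) ≤
              c₀ * max 1 c₀ * (Real.sqrt qplus / s.re) *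
                LippmannSchwinger.weightedNorm D q v ∧
          LippmannSchwinger.h2Seminorm (V (q • v : LippmannSchwinger.L2On D)) ≤
              C * (‖s‖ / s.re) * LippmannSchwinger.weightedNorm D q v) := by
  open LippmannSchwinger in
  -- In `|k| / Re k` the factors `c₀` cancel, so `C` is just the constant from the weight.
  refine ⟨√qplus, fun c₀ s hc hs => ?_⟩
  have hk : 0 < (s / (c₀ : ℂ)).re := by
    rw [Complex.div_ofReal_re]
    positivity
  have hre : (s / (c₀ : ℂ)).re = s.re / c₀ := Complex.div_ofReal_re _ _
  have hnorm : ‖s / (c₀ : ℂ)‖ = ‖s‖ / c₀ := by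
    rw [norm_div, Complex.norm_real, Real.norm_eq_abs, abs_of_pos hc]
  have hs0 : 0 < ‖s‖ := hs.trans_le (Complex.re_le_norm s)
  refine ⟨potentialOp hk hD, fun f => ⟨fun x => integrableOn_fundSol_mul hk f x, ?_⟩, ?_,
    fun v => ?_⟩
  · rw [coe_potentialOp]
    exact resolvent_extendZero_ae_eq hk hD f
  · obtain ⟨M, hM⟩ := exists_h2Norm_resolvent_le hk
    refine ⟨M, fun f => ?_⟩
    rw [coe_potentialOp, ← norm_extendZero hD f]
    exact hM _
  · have hv := norm_smul_le_weightedNorm q hq v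
    rw [← norm_extendZero hD] at hv
    rw [coe_potentialOp]
    generalize extendZero hD (q • v : L2On D) = u at hv ⊢
    refine ⟨?_, ?_, ?_⟩
    · refine (l2NormOn_le_norm D _).trans ((norm_resolvent_apply_le hk u).trans ?_)
      refine (mul_le_mul_of_nonneg_left hv (by positivity)).trans_eq ?_
      rw [hre, hnorm]
      field_simp
    · refine (h1sNorm_resolvent_le hk u hc (s := s) ?_).trans ?_
      · rw [hnorm]
        field_simp
      refine (mul_le_mul_of_nonneg_left hv (by positivity)).trans_eq ?_
      rw [hre]
      field_simp
    · refine (h2Seminorm_resolvent_le hk u).trans ?_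
      refine (mul_le_mul_of_nonneg_left hv (by positivity)).trans_eq ?_
      rw [hre, hnorm]
      field_simp
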